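/- Let $\lambda$ be an uncountable cardinal and let $\chi\in\{2,\omega\}$. Let $\mathrm{NS}_{\lambda^+}$ be the collection of nonstationary subsets of $\lambda^+$, and let $E^{\lambda^+}_\theta=\{\alpha<\lambda^+\mid \mathrm{cf}(\alpha)=\theta\}$. We use the following notions. 1. $J_\chi[\lambda^+]$ is the collection of all $S\subseteq\lambda^+$ for which there are a club $C\subseteq\lambda^+$ and functions $f_i:\lambda^+\to[\lambda^+]^{<\chi}$ $(i<\lambda^+)$ such that for every $\alpha\in S\cap C$, every regressive $f:\alpha\to\alpha$ (that is, $f(\beta)<\beta$ for all nonzero $\beta<\alpha$) and every cofinal $B\subseteq\alpha$, there is $i<\alpha$ with $\sup\{\beta\in B\mid f(\beta)\in f_i(\beta)\}=\alpha$. 2. For a cardinal $\theta$, $m(\theta,\lambda,\theta,\chi)$ is the least size of a family $\mathcal H$ of functions from $\theta$ to $[\lambda]^{<\chi}$ such that for every $X\subseteq\theta$ with $|X|=\theta$ and every function $g:X\to\lambda$ there is $h\in\mathcal H$ with $|\{\xi\in X\mid g(\xi)\in h(\xi)\}|=\theta$. 3. For a map $d:\lambda^+\times\lambda^+\to\lambda$,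 $A(d)$ is the set of all $\alpha<\lambda^+$ such that for every cofinal $B\subseteq\alpha$ there are $\eta<\alpha$ and a set $B'\subseteq B$, cofinal in $\alpha$, on which $\beta\mapsto d(\eta,\beta)$ is injective. 4. A $\lambda^+$-complete ideal over $\lambda^+$ is a collection of subsets of $\lambda^+$ that contains $\emptyset$ and is closed under subsets and under unions of at most $\lambda$ of its members. Then $J_\chi[\lambda^+]$ is the $\lambda^+$-complete ideal generated by $$\{A(d)\cap E^{\lambda^+}_\theta\mid \theta<\lambda \text{ a cardinal with } m(\theta,\lambda,\theta,\chi)=\lambda,\ d:\lambda^+\times\lambda^+\to\lambda\}\cup\mathrm{NS}_{\lambda^+}.$$ That is, $J_\chi[\lambda^+]$ is a $\lambda^+$-complete ideal over $\lambda^+$, it includes this family, and it is contained in every $\lambda^+$-complete ideal over $\lambda^+$ that includes this family. -/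

import Mathlib

open Cardinal Order Set

universe u

/-- The well-ordered set of all ordinals below the initial ordinal of the cardinal `κ`,
that is, `κ` itself viewed as a von Neumann ordinal. -/
abbrev OrdBelow (κ : Cardinal.{u}) : Type u := κ.ord.ToType

/-- `B` is a cofinal subset of the ordinal `α`: `B ⊆ α` and every `γ < α` is bounded by some
`β ∈ B`. -/
def IsCofinalIn {κ : Cardinal.{u}} (B : Set (OrdBelow κ)) (α : OrdBelow κ) : Prop :=
  B ⊆ Iio α ∧ ∀ γ < α, ∃ β ∈ B, γ ≤ β

/-- `f` restricts to a regressive function from `α` to `α`: it maps `α` into `α`, and `f β < β`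
for all nonzero `β < α`. -/
def IsRegressiveOn {κ : Cardinal.{u}} (f : OrdBelow κ → OrdBelow κ) (α : OrdBelow κ) : Prop :=
  ∀ β < α, f β < α ∧ (¬ IsMin β → f β < β)

/-- `E^κ_θ`: the set of all `α < κ` of cofinality `θ`. -/
def cofSet (κ θ : Cardinal.{u}) : Set (OrdBelow κ) :=
  {α | Order.cof (Iio α) = θ}

/-- `NS_κ`: the collection of nonstationary subsets of `κ`. -/
def nonstationaryIdeal (κ : Cardinal.{u}) : Set (Set (OrdBelow κ)) :=
  {S | ¬ IsStationary S}

/-- `m(Δ, lam, θ, χ)`: the least size of a family `H` of functions from `Δ` to `[lam]^{<χ}` such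
that for every `X ⊆ Δ` of size `θ` and every function `g : X → lam` there is `h ∈ H` for which
`{ξ ∈ X | g ξ ∈ h ξ}` has size `θ`. -/
noncomputable def meetingNumber (Δ : Type u) (lam θ χ : Cardinal.{u}) : Cardinal.{u} :=
  sInf {c | ∃ H : Set (Δ → Set (OrdBelow lam)), #H = c ∧
    (∀ h ∈ H, ∀ ξ, #(h ξ) < χ) ∧
    ∀ X : Set Δ, #X = θ → ∀ g : X → OrdBelow lam,
      ∃ h ∈ H, #{ξ : X // g ξ ∈ h ξ} = θ}

/-- `J_χ[κ]`: the collection of all `S ⊆ κ` for which there are a club `C ⊆ κ` and functions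
`F i : κ → [κ]^{<χ}` for `i < κ` such that for all `α ∈ S ∩ C`, all regressive `f : α → α` and all
cofinal `B ⊆ α`, there is `i < α` with `sup {β ∈ B | f β ∈ F i β} = α`. -/
def regressiveIdeal (χ κ : Cardinal.{u}) : Set (Set (OrdBelow κ)) :=
  {S | ∃ C : Set (OrdBelow κ), IsClub C ∧
    ∃ F : OrdBelow κ → OrdBelow κ → Set (OrdBelow κ), (∀ i β, #(F i β) < χ) ∧
      ∀ α ∈ S ∩ C, ∀ f : OrdBelow κ → OrdBelow κ, IsRegressiveOn f α →
        ∀ B : Set (OrdBelow κ), IsCofinalIn B α →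
          ∃ i < α, IsLUB {β ∈ B | f β ∈ F i β} α}

/-- `A(d)`, for a map `d : κ × κ → lam`: the set of all `α < κ` such that for every cofinal
`B ⊆ α` there are `η < α` and a cofinal subset `B'` of `α` with `B' ⊆ B` on which
`β ↦ d (η, β)` is injective. -/
def injectivitySet {κ lam : Cardinal.{u}} (d : OrdBelow κ × OrdBelow κ → OrdBelow lam) :
    Set (OrdBelow κ) :=
  {α | ∀ B, IsCofinalIn B α →
    ∃ η < α, ∃ B', B' ⊆ B ∧ IsCofinalIn B' α ∧ InjOn (fun β => d (η, β)) B'}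

/-- `I` is a `μ`-complete ideal over `T`: it contains the empty set, is closed under subsets, and
is closed under unions of fewer than `μ` of its members. -/
structure IsCompleteIdeal {T : Type u} (μ : Cardinal.{u}) (I : Set (Set T)) : Prop where
  empty_mem : ∅ ∈ I
  subset_mem : ∀ S ∈ I, ∀ S' ⊆ S, S' ∈ I
  sUnion_mem : ∀ 𝒜 ⊆ I, #𝒜 < μ → ⋃₀ 𝒜 ∈ I

/-! Two inclusions. Throughout, `χ ≤ ℵ₀` makes all guessing sets finite.

Each generator lies in `regressiveIdeal` (`injectivitySet_inter_cofSet_mem`). A meeting family on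
`θ` yields `lam` many functions on `lam` meeting every partial function with domain of size `θ`
(`IsMeetingFamily.exists_transfer`). If `d (η, ·)` is injective on a cofinal set of order type `θ`,
a regressive `f`, with its values coded in `lam`, becomes such a partial function of `d (η, β)`, so
guesses for it are indexed by a member of the family and `η < α`.

Conversely, let `F` witness membership of `S`, and test it only on functions bounded by a fixed `a₀`
below which `lam` injects. Below one `α` of cofinality `θ` the functions `F i`, `i < α`, form a
meeting family on `θ` (`meetingNumber_eq_of_guesses`), and diagonalization excludes `θ = lam`
(`Guesses.cof_ne`). Guessing a copy of the identity on `θ` makes a bound of the finite set `F i β`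
into the required `d` (`exists_subset_injectivitySet`). Thus `S` splits into at most `lam` many sets
below generators and a nonstationary set. -/

theorem mk_Iio_ordBelow_lt {κ : Cardinal.{u}} (α : OrdBelow κ) : #(Iio α) < κ :=
  (mk_Iio_lt α (by simp)).trans_eq (mk_ord_toType κ)

/-! ### Bounds and closure points in a successor cardinal. -/

section Successor

variable {lam : Cardinal.{u}}

theorem cof_ordBelow_succ (hlam : ℵ₀ ≤ lam) : Order.cof (OrdBelow (succ lam)) = succ lam := by
  rw [Ordinal.cof_toType, (isRegular_succ hlam).cof_ord]

theorem mk_Iio_le_of_succ (α : OrdBelow (succ lam)) : #(Iio α) ≤ lam :=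
  lt_succ_iff.1 (mk_Iio_ordBelow_lt α)

theorem exists_strict_bound (hlam : ℵ₀ ≤ lam) {ι : Type u} (hι : #ι ≤ lam)
    (f : ι → OrdBelow (succ lam)) : ∃ b, ∀ i, f i < b := by
  have h : ¬ IsCofinal (range f) := fun h ↦ by
    have h1 := (cof_le h).trans mk_range_le
    rw [cof_ordBelow_succ hlam] at h1
    exact (lt_succ_of_le hι).not_ge h1
  obtain ⟨b, hb⟩ := not_isCofinal_iff.1 h
  exact ⟨b, fun i ↦ hb _ ⟨i, rfl⟩⟩

/-- For unboundedness, iterate a step past `h` on initial segments `ω` times and take the supremum,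
which exists as the cofinality is uncountable. -/
theorem isClub_setOf_closed (hlam : ℵ₀ ≤ lam) (a₀ : OrdBelow (succ lam))
    (h : OrdBelow (succ lam) → OrdBelow (succ lam)) :
    IsClub {α | a₀ < α ∧ ∀ η < α, h η < α} := by
  refine ⟨fun t ht ht₀ _ a ha ↦ ⟨?_, fun η hη ↦ ?_⟩, fun a ↦ ?_⟩
  · obtain ⟨x, hx⟩ := ht₀
    exact (ht hx).1.trans_le (ha.1 hx)
  · obtain ⟨x, hx, hηx⟩ := (lt_isLUB_iff ha).1 hη
    exact ((ht hx).2 η hηx).trans_le (ha.1 hx)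
  · have step (x : OrdBelow (succ lam)) : ∃ y, x < y ∧ a₀ < y ∧ ∀ η < x, h η < y := by
      obtain ⟨y₁, hy₁⟩ := exists_strict_bound hlam (mk_Iio_le_of_succ x) fun η : Iio x ↦ h η
      obtain ⟨y₂, hy₂⟩ := exists_strict_bound hlam (ι := ULift.{u} (Fin 3))
        (by simpa using (natCast_lt_aleph0 (n := 3)).le.trans hlam) (fun i ↦ ![x, a₀, y₁] i.down)
      exact ⟨y₂, by simpa using hy₂ ⟨0⟩, by simpa using hy₂ ⟨1⟩, fun η hη ↦
        (hy₁ ⟨η, hη⟩).trans (by simpa using hy₂ ⟨2⟩)⟩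
    choose s hs₁ hs₂ hs₃ using step
    let g : ℕ → OrdBelow (succ lam) := fun n ↦ s^[n] a
    have hg (n : ℕ) : g (n + 1) = s (g n) := Function.iterate_succ_apply' s n a
    have hbdd : (upperBounds (range g)).Nonempty := by
      obtain ⟨b, hb⟩ := exists_strict_bound hlam (ι := ULift.{u} ℕ) (by simpa using hlam)
        (fun n ↦ g n.down)
      exact ⟨b, by rintro _ ⟨n, rfl⟩; exact (hb ⟨n⟩).le⟩
    obtain ⟨c, hc, hcmin⟩ := WellFounded.has_min (wellFounded_lt (α := OrdBelow (succ lam))) _ hbdd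
    have hlub : IsLUB (range g) c := ⟨hc, fun b hb ↦ not_lt.1 (hcmin b hb)⟩
    refine ⟨c, ⟨?_, fun η hη ↦ ?_⟩, hc ⟨0, rfl⟩⟩
    · exact (hs₂ (g 0)).trans_le (hg 0 ▸ hc ⟨1, rfl⟩)
    · obtain ⟨_, ⟨n, rfl⟩, hn⟩ := (lt_isLUB_iff hlub).1 hη
      exact (hs₃ (g n) η hn).trans_le (hg n ▸ hc ⟨n + 1, rfl⟩)

theorem exists_club_closed (hlam : ℵ₀ ≤ lam) {P : Type u} (hP : #P ≤ lam)
    (a₀ : OrdBelow (succ lam)) (G : P → OrdBelow (succ lam) → OrdBelow (succ lam)) :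
    ∃ C : Set (OrdBelow (succ lam)), IsClub C ∧ ∀ α ∈ C, a₀ < α ∧
      (∀ η < α, ∃ x, η < x ∧ x < α) ∧ ∀ p, ∀ η < α, G p η < α := by
  have hP' : #(Option P) ≤ lam := by
    rw [mk_option]
    exact add_le_of_le hlam hP (one_le_aleph0.trans hlam)
  choose h hh using fun η ↦ exists_strict_bound hlam hP'
    (fun p : Option P ↦ p.elim η fun p ↦ G p η)
  refine ⟨_, isClub_setOf_closed hlam a₀ h, fun α hα ↦ ⟨hα.1, fun η hη ↦ ?_, fun p η hη ↦ ?_⟩⟩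
  · exact ⟨h η, hh η none, hα.2 η hη⟩
  · exact (hh η (some p)).trans (hα.2 η hη)

theorem exists_injective_code (hlam : ℵ₀ ≤ lam) {P : Type u} (hP : #P ≤ lam) :
    ∃ c : P × OrdBelow (succ lam) → OrdBelow (succ lam), Function.Injective c := by
  have : #(P × OrdBelow (succ lam)) ≤ #(OrdBelow (succ lam)) := by
    rw [mk_prod, lift_id, lift_id, mk_ord_toType]
    exact mul_le_of_le (hlam.trans (le_succ _)) (hP.trans (le_succ _)) le_rfl
  obtain ⟨c⟩ := this
  exact ⟨c, c.injective⟩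

end Successor

/-! ### Cofinal sets and increasing `θ`-sequences. -/

section CofinalSequences

variable {κ : Cardinal.{u}} {α : OrdBelow κ} {B : Set (OrdBelow κ)}

theorem IsCofinalIn.isLUB (hlim : ∀ η < α, ∃ x, η < x ∧ x < α) (hB : IsCofinalIn B α) :
    IsLUB B α := by
  refine ⟨fun x hx ↦ (hB.1 hx).le, fun b hb ↦ not_lt.1 fun hba ↦ ?_⟩
  obtain ⟨x, hbx, hx⟩ := hlim b hba
  obtain ⟨β, hβ, hxβ⟩ := hB.2 x hx
  exact (hbx.trans_le (hxβ.trans (hb hβ))).false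

theorem IsCofinalIn.of_isLUB (hB : B ⊆ Iio α) (h : IsLUB B α) : IsCofinalIn B α :=
  ⟨hB, fun _ hγ ↦ let ⟨β, hβ, hγβ⟩ := (lt_isLUB_iff h).1 hγ; ⟨β, hβ, hγβ.le⟩⟩

theorem IsCofinalIn.mono {B' : Set (OrdBelow κ)} (hB : IsCofinalIn B α) (h : B ⊆ B')
    (h' : B' ⊆ Iio α) : IsCofinalIn B' α :=
  ⟨h', fun γ hγ ↦ let ⟨β, hβ, hγβ⟩ := hB.2 γ hγ; ⟨β, h hβ, hγβ⟩⟩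

theorem IsCofinalIn.inter_Ici (hB : IsCofinalIn B α) {a : OrdBelow κ} (ha : a < α) :
    IsCofinalIn (B ∩ Ici a) α :=
  ⟨fun _ hx ↦ hB.1 hx.1, fun γ hγ ↦
    let ⟨β, hβ, h⟩ := hB.2 (max γ a) (max_lt hγ ha)
    ⟨β, ⟨hβ, (le_max_right _ _).trans h⟩, (le_max_left _ _).trans h⟩⟩

theorem isCofinalIn_Iio : IsCofinalIn (Iio α) α :=
  ⟨subset_rfl, fun γ hγ ↦ ⟨γ, hγ, le_rfl⟩⟩

theorem aleph0_le_cof_of_forall_exists_lt {a : OrdBelow κ} (ha : a < α)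
    (hlim : ∀ η < α, ∃ x, η < x ∧ x < α) : ℵ₀ ≤ Order.cof (Iio α) := by
  have : Nonempty (Iio α) := ⟨⟨a, ha⟩⟩
  have : NoMaxOrder (Iio α) := ⟨fun η ↦ let ⟨x, h, h'⟩ := hlim η.1 η.2; ⟨⟨x, h'⟩, h⟩⟩
  exact aleph0_le_cof

/-- A cofinal subset of an ordinal of cofinality `θ` contains an increasing cofinal
`θ`-sequence. -/
theorem IsCofinalIn.exists_strictMono {θ : Cardinal.{u}} (hθ : Order.cof (Iio α) = θ)
    (hB : IsCofinalIn B α) :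
    ∃ e : OrdBelow θ → OrdBelow κ, StrictMono e ∧ range e ⊆ B ∧ IsCofinalIn (range e) α := by
  have hs : IsCofinal (Subtype.val ⁻¹' B : Set (Iio α)) := fun γ ↦
    let ⟨β, hβ, h⟩ := hB.2 γ.1 γ.2
    ⟨⟨β, hB.1 hβ⟩, hβ, h⟩
  obtain ⟨t, ht, htc, htt⟩ := Ordinal.exists_ord_cof_eq_of_isCofinal hs
  rw [hθ, ← Ordinal.type_toType θ.ord] at htt
  obtain ⟨i⟩ := Ordinal.type_eq.1 htt
  refine ⟨fun ξ ↦ (i.symm ξ).1.1, fun x y h ↦ i.symm.map_rel_iff.2 h, ?_, ?_, fun γ hγ ↦ ?_⟩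
  · rintro _ ⟨ξ, rfl⟩
    exact ht (i.symm ξ).2
  · rintro _ ⟨ξ, rfl⟩
    exact (i.symm ξ).1.2
  · obtain ⟨β, hβ, h⟩ := htc ⟨γ, hγ⟩
    exact ⟨β.1, ⟨i ⟨β, hβ⟩, by simp⟩, h⟩

theorem isCofinal_of_mk_eq {θ : Cardinal.{u}} {X : Set (OrdBelow θ)} (hX : #X = θ) :
    IsCofinal X := by
  by_contra h
  obtain ⟨ζ, hζ⟩ := not_isCofinal_iff.1 h
  exact ((mk_le_mk_of_subset (t := Iio ζ) hζ).trans_lt (mk_Iio_ordBelow_lt ζ)).ne hX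

theorem isCofinalIn_image_iff {θ : Cardinal.{u}} (hθ : Order.cof (Iio α) = θ)
    {e : OrdBelow θ → OrdBelow κ} (he : StrictMono e) (hec : IsCofinalIn (range e) α)
    {X : Set (OrdBelow θ)} : IsCofinalIn (e '' X) α ↔ #X = θ := by
  refine ⟨fun h ↦ ?_, fun h ↦ ⟨(image_subset_range e X).trans hec.1, fun γ hγ ↦ ?_⟩⟩
  · refine ((mk_set_le X).trans_eq (mk_ord_toType θ)).antisymm ?_
    have hc : IsCofinal (range fun ξ : X ↦ (⟨e ξ, hec.1 ⟨ξ, rfl⟩⟩ : Iio α)) := fun γ ↦ by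
      obtain ⟨_, ⟨ξ, hξ, rfl⟩, hle⟩ := h.2 γ.1 γ.2
      exact ⟨_, ⟨⟨ξ, hξ⟩, rfl⟩, hle⟩
    exact (hθ.symm.trans_le (cof_le hc)).trans mk_range_le
  · obtain ⟨_, ⟨ζ, rfl⟩, hζ⟩ := hec.2 γ hγ
    obtain ⟨ξ, hξ, hζξ⟩ := isCofinal_of_mk_eq h ζ
    exact ⟨e ξ, ⟨ξ, hξ, rfl⟩, hζ.trans (he.monotone hζξ)⟩

end CofinalSequences

/-! ### Meeting families and meeting numbers. -/

/-- `H` is a family of functions from `Δ` to `[lam]^{<χ}` meeting every function with domain a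
subset of `Δ` of size `θ` at `θ` many points. -/
structure IsMeetingFamily {Δ : Type u} {lam : Cardinal.{u}} (θ χ : Cardinal.{u})
    (H : Set (Δ → Set (OrdBelow lam))) : Prop where
  mk_lt : ∀ h ∈ H, ∀ ξ, #(h ξ) < χ
  exists_mk_eq : ∀ X : Set Δ, #X = θ → ∀ g : Δ → OrdBelow lam,
    ∃ h ∈ H, #{ξ | ξ ∈ X ∧ g ξ ∈ h ξ} = θ

section Meeting

variable {lam θ χ : Cardinal.{u}}

theorem mk_setOf_subtype {Δ : Type u} (X : Set Δ) (p : Δ → Prop) :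
    #{ξ : X // p ξ} = #{ξ | ξ ∈ X ∧ p ξ} :=
  mk_congr (Equiv.subtypeSubtypeEquivSubtypeInter (· ∈ X) p)

theorem nonempty_ordBelow (h : lam ≠ 0) : Nonempty (OrdBelow lam) := by
  rw [← mk_ne_zero_iff, mk_ord_toType]
  exact h

/-- Partial functions extend arbitrarily, so testing against total ones is enough. -/
theorem meetingNumber_eq {Δ : Type u} (hlam : lam ≠ 0) :
    meetingNumber Δ lam θ χ =
      sInf {c | ∃ H : Set (Δ → Set (OrdBelow lam)), #H = c ∧ IsMeetingFamily θ χ H} := by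
  have := nonempty_ordBelow hlam
  unfold meetingNumber
  congr 1
  ext c
  refine exists_congr fun H ↦ and_congr_right fun _ ↦
    ⟨fun h ↦ ⟨h.1, fun X hX g ↦ ?_⟩, fun h ↦ ⟨h.1, fun X hX g ↦ ?_⟩⟩
  · obtain ⟨h', hh, he⟩ := h.2 X hX fun ξ ↦ g ξ
    exact ⟨h', hh, (mk_setOf_subtype X fun ξ ↦ g ξ ∈ h' ξ).symm.trans he⟩
  · obtain ⟨h', hh, he⟩ := h.2 X hX (Function.extend Subtype.val g fun _ ↦ Classical.arbitrary _)
    refine ⟨h', hh, he ▸ ?_⟩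
    rw [← mk_setOf_subtype X fun ξ ↦ Function.extend Subtype.val g _ ξ ∈ h' ξ]
    simp only [Subtype.val_injective.extend_apply]

theorem exists_isMeetingFamily {Δ : Type u} (hlam : lam ≠ 0)
    (h : meetingNumber Δ lam θ χ = lam) :
    ∃ H : Set (Δ → Set (OrdBelow lam)), #H = lam ∧ IsMeetingFamily θ χ H := by
  rw [meetingNumber_eq hlam] at h
  -- Without any meeting family the infimum would be `0`.
  rcases eq_empty_or_nonempty
    {c | ∃ H : Set (Δ → Set (OrdBelow lam)), #H = c ∧ IsMeetingFamily θ χ H} with he | hne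
  · rw [he, Cardinal.sInf_empty] at h
    exact (hlam h.symm).elim
  · have := csInf_mem hne
    rwa [h] at this

theorem exists_forall_notMem (hlam : ℵ₀ < lam) {ι : Type u} (hι : #ι < lam)
    (t : ι → Set (OrdBelow lam)) (ht : ∀ i, #(t i) < ℵ₀) : ∃ x, ∀ i, x ∉ t i := by
  have h : #(⋃ i, t i) < lam :=
    (mk_iUnion_le_sum_mk.trans (sum_le_sum _ (fun _ ↦ ℵ₀) fun i ↦ (ht i).le)).trans_lt (by
      rw [sum_const']
      exact mul_lt_of_lt hlam.le hι hlam)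
  by_contra! hc
  have : ⋃ i, t i = Set.univ := eq_univ_of_forall fun x ↦ mem_iUnion.2 (hc x)
  rw [this, mk_univ, mk_ord_toType] at h
  exact h.false

/-- Fewer than `lam` functions with finite values can be evaded at every point, which gives the
lower bound. -/
theorem meetingNumber_eq_of_isMeetingFamily (hlam : ℵ₀ < lam) (hχ : χ ≤ ℵ₀) (hθ : θ ≠ 0)
    {H : Set (OrdBelow θ → Set (OrdBelow lam))} (hH : IsMeetingFamily θ χ H) (hle : #H ≤ lam) :
    meetingNumber (OrdBelow θ) lam θ χ = lam := by
  rw [meetingNumber_eq (aleph0_pos.trans hlam).ne']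
  have hmem : #H ∈ {c | ∃ H : Set (OrdBelow θ → Set (OrdBelow lam)), #H = c ∧
      IsMeetingFamily θ χ H} := ⟨H, rfl, hH⟩
  refine ((csInf_le' hmem).trans hle).antisymm (le_csInf ⟨_, hmem⟩ ?_)
  rintro _ ⟨H', rfl, hH'⟩
  by_contra! hlt
  choose g hg using fun ξ ↦ exists_forall_notMem hlam (ι := H')
    hlt (fun h : H' ↦ h.1 ξ) fun h ↦ (hH'.mk_lt h.1 h.2 ξ).trans_le hχ
  obtain ⟨h, hh, he⟩ := hH'.exists_mk_eq Set.univ (by rw [mk_univ, mk_ord_toType]) g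
  have hne := mk_ne_zero_iff.1 (he.trans_ne hθ)
  obtain ⟨ξ⟩ := hne
  exact hg ξ.1 ⟨h, hh⟩ ξ.2.2

/-- A meeting family on `θ` gives one on `lam`. -/
theorem IsMeetingFamily.exists_transfer (hθ : ℵ₀ ≤ θ) (hχ : χ ≤ ℵ₀)
    {H : Set (OrdBelow θ → Set (OrdBelow lam))} (hH : IsMeetingFamily θ χ H) :
    ∃ k : H × H → OrdBelow lam → Set (OrdBelow lam), (∀ p x, #(k p x) < χ) ∧
      ∀ X : Set (OrdBelow lam), #X = θ → ∀ g : OrdBelow lam → OrdBelow lam,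
        ∃ p, θ ≤ #{x | x ∈ X ∧ g x ∈ k p x} := by
  have := nonempty_ordBelow (aleph0_pos.trans_le hθ).ne'
  have hA (h : H) : #(⋃ ξ, h.1 ξ) ≤ #(OrdBelow θ) := by
    refine (mk_iUnion_le_sum_mk.trans (sum_le_sum _ (fun _ ↦ ℵ₀) fun ξ ↦
      ((hH.mk_lt h.1 h.2 ξ).trans_le hχ).le)).trans ?_
    rw [sum_const', mk_ord_toType]
    exact mul_le_of_le hθ le_rfl hθ
  have hA' (h : H) : ∃ a : OrdBelow lam → OrdBelow θ, InjOn a (⋃ ξ, h.1 ξ) := by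
    obtain ⟨a⟩ := hA h
    refine ⟨Function.extend Subtype.val a fun _ ↦ Classical.arbitrary _, fun x hx y hy hxy ↦ ?_⟩
    have := Subtype.val_injective.extend_apply a (fun _ ↦ Classical.arbitrary _) ⟨x, hx⟩
    have h' := Subtype.val_injective.extend_apply a (fun _ ↦ Classical.arbitrary _) ⟨y, hy⟩
    exact congrArg Subtype.val (a.injective (this.symm.trans (hxy.trans h')))
  choose a ha using hA'
  -- The family is used twice: the first member traps `θ` many points of `X` in a set of size at
  -- most `θ`, the second meets `g` after `a` moves these points into `θ`.
  refine ⟨fun p x ↦ p.2.1 (a p.1 x), fun p x ↦ hH.mk_lt _ p.2.2 _, fun X hX g ↦ ?_⟩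
  have hX' : #(OrdBelow θ) = #X := by rw [hX, mk_ord_toType]
  obtain ⟨u⟩ := Cardinal.eq.1 hX'
  have : Nonempty (OrdBelow lam) := ⟨u (Classical.arbitrary _)⟩
  obtain ⟨h, hh, hh'⟩ := hH.exists_mk_eq Set.univ (by rw [mk_univ, mk_ord_toType]) fun ξ ↦ (u ξ).1
  let Y : Set (OrdBelow lam) := (fun ξ ↦ (u ξ).1) '' {ξ | ξ ∈ Set.univ ∧ (u ξ).1 ∈ h ξ}
  have hY : #Y = θ := (mk_image_eq (Subtype.val_injective.comp u.injective)).trans hh'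
  have hYA : Y ⊆ ⋃ ξ, h ξ := by
    rintro _ ⟨ξ, hξ, rfl⟩
    exact mem_iUnion.2 ⟨ξ, hξ.2⟩
  have hYa : InjOn (a ⟨h, hh⟩) Y := (ha ⟨h, hh⟩).mono hYA
  obtain ⟨h', hm, he⟩ := hH.exists_mk_eq (a ⟨h, hh⟩ '' Y)
    ((mk_image_eq_of_injOn _ _ hYa).trans hY) (g ∘ Function.invFunOn (a ⟨h, hh⟩) Y)
  refine ⟨(⟨h, hh⟩, ⟨h', hm⟩), ?_⟩
  refine he.symm.trans_le ?_
  refine (mk_le_mk_of_subset (t := a ⟨h, hh⟩ '' _) ?_).trans mk_image_le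
  rintro _ ⟨⟨y, hy, rfl⟩, hg⟩
  rw [Function.comp_apply, hYa.leftInvOn_invFunOn hy] at hg
  refine ⟨y, ⟨?_, hg⟩, rfl⟩
  obtain ⟨ξ, -, rfl⟩ := hy
  exact (u ξ).2

end Meeting

/-! ### The ideal properties, and membership of the generators. -/

section Ideal

variable {lam θ χ : Cardinal.{u}}

theorem isCompleteIdeal_regressiveIdeal (hlam : ℵ₀ ≤ lam) (hχ : χ ≠ 0) :
    IsCompleteIdeal (succ lam) (regressiveIdeal χ (succ lam)) where
  empty_mem := ⟨Set.univ, .univ, fun _ _ ↦ ∅, fun _ _ ↦ by simpa [pos_iff_ne_zero] using hχ,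
    fun _ hα ↦ hα.1.elim⟩
  subset_mem := fun S ⟨C, hC, F, hF, h⟩ S' hS ↦
    ⟨C, hC, F, hF, fun α hα ↦ h α ⟨hS hα.1, hα.2⟩⟩
  sUnion_mem := fun 𝒜 h𝒜 hcard ↦ by
    choose C hC F hF h using fun S : 𝒜 ↦ h𝒜 S.2
    have hP : #𝒜 ≤ lam := lt_succ_iff.1 hcard
    obtain ⟨c, hc⟩ := exists_injective_code hlam hP
    have : Nonempty (OrdBelow (succ lam)) := nonempty_ordBelow (succ_ne_zero _)
    -- At closure points of the coding, an index `i < α` for a member of `𝒜` has its code below `α`.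
    obtain ⟨D, hD, hD'⟩ := exists_club_closed hlam hP (Classical.arbitrary _)
      fun S η ↦ c (S, η)
    have hcof := cof_ordBelow_succ hlam
    have hcof' : Order.cof (OrdBelow (succ lam)) ≠ ℵ₀ := by
      rw [hcof]
      exact (hlam.trans_lt (lt_succ lam)).ne'
    have hCC : IsClub (⋂ S, C S) := .iInter hcof' (by simpa [hcof] using hP) hC
    refine ⟨(⋂ S, C S) ∩ D, hCC.inter hcof' hD,
      Function.extend c (fun p ↦ F p.1 p.2) fun _ _ ↦ ∅, fun i β ↦ ?_, ?_⟩
    · by_cases hi : ∃ p, c p = i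
      · obtain ⟨p, rfl⟩ := hi
        rw [hc.extend_apply]
        exact hF _ _ _
      · rw [Function.extend_apply' _ _ _ hi]
        simpa [pos_iff_ne_zero] using hχ
    · rintro α ⟨⟨S, hS, hα⟩, hαC, hαD⟩ f hf B hB
      obtain ⟨i, hi, hlub⟩ := h ⟨S, hS⟩ α ⟨hα, mem_iInter.1 hαC _⟩ f hf B hB
      refine ⟨c (⟨S, hS⟩, i), (hD' α hαD).2.2 _ _ hi, ?_⟩
      rwa [hc.extend_apply]

theorem nonstationaryIdeal_subset_regressiveIdeal (hχ : χ ≠ 0) (κ : Cardinal.{u}) :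
    nonstationaryIdeal κ ⊆ regressiveIdeal χ κ := fun S hS ↦ by
  obtain ⟨C, hC, hd⟩ := not_isStationary_iff.1 hS
  exact ⟨C, hC, fun _ _ ↦ ∅, fun _ _ ↦ by simpa [pos_iff_ne_zero] using hχ,
    fun α hα ↦ (disjoint_left.1 hd hα.1 hα.2).elim⟩

theorem exists_injOn_Iio (hlam : lam ≠ 0) :
    ∃ e : OrdBelow (succ lam) → OrdBelow (succ lam) → OrdBelow lam, ∀ β, InjOn (e β) (Iio β) := by
  have := nonempty_ordBelow hlam
  have h (β : OrdBelow (succ lam)) : ∃ e : OrdBelow (succ lam) → OrdBelow lam,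
      InjOn e (Iio β) := by
    obtain ⟨a⟩ : #(Iio β) ≤ #(OrdBelow lam) := by
      rw [mk_ord_toType]
      exact mk_Iio_le_of_succ β
    refine ⟨Function.extend Subtype.val a fun _ ↦ Classical.arbitrary _, fun x hx y hy hxy ↦ ?_⟩
    have h₁ := Subtype.val_injective.extend_apply a (fun _ ↦ Classical.arbitrary _) ⟨x, hx⟩
    have h₂ := Subtype.val_injective.extend_apply a (fun _ ↦ Classical.arbitrary _) ⟨y, hy⟩
    exact congrArg Subtype.val (a.injective (h₁.symm.trans (hxy.trans h₂)))
  exact ⟨fun β ↦ (h β).choose, fun β ↦ (h β).choose_spec⟩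

theorem injectivitySet_inter_cofSet_mem (hlam : ℵ₀ < lam) (hχ : χ ≤ ℵ₀) (hχ₀ : χ ≠ 0)
    (hm : meetingNumber (OrdBelow θ) lam θ χ = lam)
    (d : OrdBelow (succ lam) × OrdBelow (succ lam) → OrdBelow lam) :
    injectivitySet d ∩ cofSet (succ lam) θ ∈ regressiveIdeal χ (succ lam) := by
  have hlam₀ : lam ≠ 0 := (aleph0_pos.trans hlam).ne'
  have : Nonempty (OrdBelow (succ lam)) := nonempty_ordBelow (succ_ne_zero _)
  rcases lt_or_ge θ ℵ₀ with hθ | hθ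
  -- For finite `θ`, the limit points form a club avoiding cofinality `θ`.
  · refine nonstationaryIdeal_subset_regressiveIdeal hχ₀ _ (not_isStationary_iff.2 ?_)
    obtain ⟨D, hD, hD'⟩ := exists_club_closed hlam.le (P := PUnit)
      (by simpa using (one_le_aleph0.trans hlam.le)) (Classical.arbitrary _) fun _ η ↦ η
    refine ⟨D, hD, disjoint_left.2 fun α hα hαD ↦ ?_⟩
    obtain ⟨h₁, h₂, -⟩ := hD' α hαD
    exact (aleph0_le_cof_of_forall_exists_lt h₁ h₂).not_gt (hα.2.trans_lt hθ)
  obtain ⟨H, hHc, hH⟩ := exists_isMeetingFamily hlam₀ hm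
  obtain ⟨k, hk, hk'⟩ := hH.exists_transfer hθ hχ
  have hP : #(H × H) ≤ lam := by
    rw [← mul_def, hHc]
    exact (mul_eq_self hlam.le).le
  obtain ⟨c, hc⟩ := exists_injective_code hlam.le hP
  obtain ⟨D, hD, hD'⟩ := exists_club_closed hlam.le hP (Classical.arbitrary _)
    fun p η ↦ c (p, η)
  obtain ⟨e, he⟩ := exists_injOn_Iio hlam₀
  -- The code of `(p, η)` guesses at `β` those `γ < β` whose `e β`-code in `lam` is predicted by `k
  -- p` at `d (η, β)`.
  refine ⟨D, hD, Function.extend c (fun p β ↦ {γ | γ < β ∧ e β γ ∈ k p.1 (d (p.2, β))})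
    fun _ _ ↦ ∅, fun i β ↦ ?_, ?_⟩
  · by_cases hi : ∃ p, c p = i
    · obtain ⟨p, rfl⟩ := hi
      rw [hc.extend_apply]
      refine lt_of_le_of_lt ?_ (hk p.1 (d (p.2, β)))
      rw [← mk_image_eq_of_injOn (e β) {γ | γ < β ∧ e β γ ∈ k p.1 (d (p.2, β))}
        ((he β).mono fun γ hγ ↦ hγ.1)]
      exact mk_le_mk_of_subset (image_subset_iff.2 fun γ hγ ↦ hγ.2)
    · rw [Function.extend_apply' _ _ _ hi]
      simpa [pos_iff_ne_zero] using hχ₀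
  rintro α ⟨⟨hαd, hαθ⟩, hαD⟩ f hf B hB
  obtain ⟨hα₀, hαlim, hαc⟩ := hD' α hαD
  -- Starting above `x` discards the least element, where regressiveness gives no `f β < β`.
  obtain ⟨x, hx₀, hx⟩ := hαlim _ hα₀
  obtain ⟨η, hη, B', hB', hB'c, hinj⟩ := hαd _ (hB.inter_Ici hx)
  obtain ⟨s, hs, hsB, hsc⟩ := hB'c.exists_strictMono hαθ
  have hsα (ξ) : s ξ < α := hsc.1 ⟨ξ, rfl⟩
  have hdinj : Function.Injective fun ξ ↦ d (η, s ξ) := fun ξ ζ h ↦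
    hs.injective (hinj (hsB ⟨ξ, rfl⟩) (hsB ⟨ζ, rfl⟩) h)
  have : Nonempty (OrdBelow lam) := nonempty_ordBelow hlam₀
  obtain ⟨p, hp⟩ := hk' (range fun ξ ↦ d (η, s ξ))
    (by rw [mk_range_eq _ hdinj, mk_ord_toType])
    (Function.extend (fun ξ ↦ d (η, s ξ)) (fun ξ ↦ e (s ξ) (f (s ξ)))
      fun _ ↦ Classical.arbitrary _)
  have hZ : #{ξ | e (s ξ) (f (s ξ)) ∈ k p (d (η, s ξ))} = θ := by
    refine ((mk_set_le _).trans_eq (mk_ord_toType θ)).antisymm (hp.trans ?_)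
    refine (mk_le_mk_of_subset (t := (fun ξ ↦ d (η, s ξ)) '' _) ?_).trans mk_image_le
    rintro _ ⟨⟨ξ, rfl⟩, h⟩
    rw [hdinj.extend_apply] at h
    exact ⟨ξ, h, rfl⟩
  refine ⟨c (p, η), hαc _ _ hη, ?_⟩
  rw [hc.extend_apply]
  refine IsCofinalIn.isLUB hαlim
    (((isCofinalIn_image_iff hαθ hs hsc).2 hZ).mono ?_ fun β hβ ↦ hB.1 hβ.1)
  rintro _ ⟨ξ, hξ, rfl⟩
  have hsx := hB' (hsB ⟨ξ, rfl⟩)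
  exact ⟨hsx.1, (hf _ (hsα ξ)).2 fun h ↦ (hx₀.trans_le hsx.2).not_ge (h (hx₀.trans_le hsx.2).le),
    hξ⟩

end Ideal

/-! ### From a guessing family back to the generators. -/

section Generation

variable {lam θ χ : Cardinal.{u}}

/-- `F` guesses, below `α`, all regressive functions on cofinal subsets of `α`. -/
def Guesses {κ : Cardinal.{u}} (F : OrdBelow κ → OrdBelow κ → Set (OrdBelow κ))
    (α : OrdBelow κ) : Prop :=
  ∀ f : OrdBelow κ → OrdBelow κ, IsRegressiveOn f α →
    ∀ B : Set (OrdBelow κ), IsCofinalIn B α → ∃ i < α, IsLUB {β ∈ B | f β ∈ F i β} α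

/-- A guessing family guesses all bounded functions on a cofinal sequence. -/
theorem Guesses.exists_mk_eq {κ : Cardinal.{u}} {F : OrdBelow κ → OrdBelow κ → Set (OrdBelow κ)}
    {α a₀ : OrdBelow κ} (hF : Guesses F α) (ha₀ : a₀ < α) (hαθ : Order.cof (Iio α) = θ)
    {e : OrdBelow θ → OrdBelow κ} (he : StrictMono e) (hec : IsCofinalIn (range e) α)
    (hea : ∀ ξ, a₀ ≤ e ξ) {X : Set (OrdBelow θ)} (hX : #X = θ) (g : OrdBelow θ → OrdBelow κ)
    (hg : ∀ ξ, g ξ < a₀) : ∃ i < α, #{ξ | ξ ∈ X ∧ g ξ ∈ F i (e ξ)} = θ := by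
  obtain ⟨z, hz⟩ : ∃ z : OrdBelow κ, ∀ x, z ≤ x := by
    obtain ⟨z, -, hz⟩ :=
      WellFounded.has_min (wellFounded_lt (α := OrdBelow κ)) Set.univ ⟨a₀, trivial⟩
    exact ⟨z, fun x ↦ not_lt.1 (hz x trivial)⟩
  -- Bounded values are regressive on a sequence starting at `a₀`; elsewhere the least element
  -- serves.
  have hf : IsRegressiveOn (Function.extend e g fun _ ↦ z) α := fun β hβ ↦ by
    by_cases h : ∃ ξ, e ξ = β
    · obtain ⟨ξ, rfl⟩ := h
      rw [he.injective.extend_apply]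
      exact ⟨(hg ξ).trans ha₀, fun _ ↦ (hg ξ).trans_le (hea ξ)⟩
    · rw [Function.extend_apply' _ _ _ h]
      refine ⟨(hz β).trans_lt hβ, fun hmin ↦ (hz β).lt_of_ne fun h' ↦ hmin fun x _ ↦ ?_⟩
      exact h' ▸ hz x
  obtain ⟨i, hi, hlub⟩ := hF _ hf (e '' X) ((isCofinalIn_image_iff hαθ he hec).2 hX)
  refine ⟨i, hi, (isCofinalIn_image_iff hαθ he hec).1 ?_⟩
  refine (IsCofinalIn.of_isLUB ?_ hlub).mono ?_ ?_
  · rintro _ ⟨⟨ξ, -, rfl⟩, -⟩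
    exact hec.1 ⟨ξ, rfl⟩
  · rintro _ ⟨⟨ξ, hξ, rfl⟩, h⟩
    rw [he.injective.extend_apply] at h
    exact ⟨ξ, ⟨hξ, h⟩, rfl⟩
  · rintro _ ⟨ξ, -, rfl⟩
    exact hec.1 ⟨ξ, rfl⟩

variable {F : OrdBelow (succ lam) → OrdBelow (succ lam) → Set (OrdBelow (succ lam))}
  {α a₀ : OrdBelow (succ lam)} {ι : OrdBelow lam → OrdBelow (succ lam)}

theorem mk_preimage_lt (hF : ∀ i β, #(F i β) < χ) (hι : Function.Injective ι)
    (i β : OrdBelow (succ lam)) : #(ι ⁻¹' F i β) < χ :=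
  (mk_preimage_of_injective ι _ hι).trans_lt (hF i β)

theorem meetingNumber_eq_of_guesses (hlam : ℵ₀ < lam) (hχ : χ ≤ ℵ₀)
    (hFχ : ∀ i β, #(F i β) < χ) (hι : Function.Injective ι) (hιa : ∀ x, ι x < a₀)
    (hF : Guesses F α) (ha₀ : a₀ < α) (hαθ : Order.cof (Iio α) = θ) (hθ : θ ≠ 0) :
    meetingNumber (OrdBelow θ) lam θ χ = lam := by
  obtain ⟨e, he, hea, hec⟩ := (isCofinalIn_Iio.inter_Ici ha₀).exists_strictMono hαθ
  refine meetingNumber_eq_of_isMeetingFamily hlam hχ hθ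
    (H := range fun (i : Iio α) ξ ↦ ι ⁻¹' F i (e ξ)) ⟨?_, fun X hX g ↦ ?_⟩
    (mk_range_le.trans (mk_Iio_le_of_succ α))
  · rintro _ ⟨i, rfl⟩ ξ
    exact mk_preimage_lt hFχ hι _ _
  · obtain ⟨i, hi, h⟩ := hF.exists_mk_eq ha₀ hαθ he hec (fun ξ ↦ (hea ⟨ξ, rfl⟩).2) hX
      (fun ξ ↦ ι (g ξ)) fun ξ ↦ hιa _
    exact ⟨_, ⟨⟨i, hi⟩, rfl⟩, h⟩

/-- Guessing fails at ordinals of cofinality `lam`, by diagonalization. -/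
theorem Guesses.cof_ne (hlam : ℵ₀ < lam) (hχ : χ ≤ ℵ₀)
    (hFχ : ∀ i β, #(F i β) < χ) (hι : Function.Injective ι) (hιa : ∀ x, ι x < a₀)
    (hF : Guesses F α) (ha₀ : a₀ < α) : Order.cof (Iio α) ≠ lam := fun hαθ ↦ by
  obtain ⟨e, he, hea, hec⟩ := (isCofinalIn_Iio.inter_Ici ha₀).exists_strictMono hαθ
  obtain ⟨s⟩ : #(Iio α) ≤ #(OrdBelow lam) := by
    rw [mk_ord_toType]
    exact mk_Iio_le_of_succ α
  -- At `ξ`, avoid the fewer than `lam` guesses with index enumerated before `ξ`; each index then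
  -- fails from some point on.
  choose g hg using fun ξ ↦ exists_forall_notMem hlam (ι := {i : Iio α // s i < ξ})
    ((mk_le_of_injective (f := fun i ↦ (⟨s i.1, i.2⟩ : Iio ξ)) fun i j h ↦
      Subtype.ext (s.injective (congrArg Subtype.val h))).trans_lt (mk_Iio_ordBelow_lt ξ))
    (fun i ↦ ι ⁻¹' F i.1 (e ξ)) fun i ↦ (mk_preimage_lt hFχ hι _ _).trans_le hχ
  obtain ⟨i, hi, h⟩ := hF.exists_mk_eq ha₀ hαθ he hec (fun ξ ↦ (hea ⟨ξ, rfl⟩).2)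
    (X := Set.univ) (by rw [mk_univ, mk_ord_toType]) (fun ξ ↦ ι (g ξ)) fun ξ ↦ hιa _
  obtain ⟨ζ, hζ⟩ : ∃ ζ, s ⟨i, hi⟩ < ζ := by
    have : NoMaxOrder (OrdBelow lam) := Cardinal.noMaxOrder hlam.le
    exact exists_gt _
  obtain ⟨ξ, hξ, hζξ⟩ := isCofinal_of_mk_eq h ζ
  exact hg ξ ⟨⟨i, hi⟩, hζ.trans_le hζξ⟩ hξ.2

/-- The image of `Z` is cofinal, hence of size `c` by regularity; keep one preimage of each value.
-/
theorem exists_injOn_of_forall_le {c : Cardinal.{u}} (hc : Order.cof (OrdBelow c) = c)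
    {Z : Set (OrdBelow c)} (hZ : #Z = c) {m : OrdBelow c → OrdBelow c}
    (hm : ∀ ξ ∈ Z, ξ ≤ m ξ) : ∃ Z' ⊆ Z, #Z' = c ∧ InjOn m Z' := by
  obtain ⟨Z', hZ', hbij⟩ := (surjOn_image m Z).exists_bijOn_subset
  refine ⟨Z', hZ', ((mk_set_le Z').trans_eq (mk_ord_toType c)).antisymm ?_, hbij.injOn⟩
  have : IsCofinal (m '' Z) := fun ζ ↦
    let ⟨ξ, hξ, h⟩ := isCofinal_of_mk_eq hZ ζ
    ⟨m ξ, ⟨ξ, hξ, rfl⟩, h.trans (hm ξ hξ)⟩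
  rw [← mk_image_eq_of_injOn _ _ hbij.injOn, hbij.image_eq]
  exact hc.symm.trans_le (cof_le this)

/-- If `F i` guesses the copy of `ξ` at `e ξ`, the bound there is at least `ξ`. This occurs for `θ`
many `ξ`, so the bounds are injective on a cofinal subset. The bounds do not mention `α`, so one `d`
serves every `α` of cofinality `θ`. -/
theorem exists_subset_injectivitySet (hθ : θ ≠ 0) (hθlam : θ ≤ lam) (hχ : χ ≤ ℵ₀)
    (hFχ : ∀ i β, #(F i β) < χ) (hι : Function.Injective ι) (hιa : ∀ x, ι x < a₀) :
    ∃ d : OrdBelow (succ lam) × OrdBelow (succ lam) → OrdBelow lam,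
      ∀ α, Guesses F α → a₀ < α → Order.cof (Iio α) = θ → α ∈ injectivitySet d := by
  have := nonempty_ordBelow hθ
  obtain ⟨j⟩ : #(OrdBelow θ) ≤ #(OrdBelow lam) := by rwa [mk_ord_toType, mk_ord_toType]
  have hmax (p : OrdBelow (succ lam) × OrdBelow (succ lam)) :
      ∃ y, ∀ ξ, ι (j ξ) ∈ F p.1 p.2 → ξ ≤ y := by
    have hfin : {ξ | ι (j ξ) ∈ F p.1 p.2}.Finite := by
      rw [← lt_aleph0_iff_set_finite]
      exact ((mk_preimage_of_injective (ι ∘ j) _ (hι.comp j.injective)).trans_lt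
        (hFχ p.1 p.2)).trans_le hχ
    exact hfin.bddAbove
  choose m hm using hmax
  refine ⟨fun p ↦ j (m p), fun α hF ha₀ hαθ B hB ↦ ?_⟩
  obtain ⟨e, he, hea, hec⟩ := (hB.inter_Ici ha₀).exists_strictMono hαθ
  obtain ⟨i, hi, h⟩ := hF.exists_mk_eq ha₀ hαθ he hec (fun ξ ↦ (hea ⟨ξ, rfl⟩).2)
    (X := Set.univ) (by rw [mk_univ, mk_ord_toType]) (fun ξ ↦ ι (j ξ)) fun ξ ↦ hιa _
  have hreg : Order.cof (OrdBelow θ) = θ := by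
    rw [Ordinal.cof_toType, ← hαθ, Order.cof_ord_cof]
  obtain ⟨Z, hZ, hZc, hinj⟩ := exists_injOn_of_forall_le hreg h
    (m := fun ξ ↦ m (i, e ξ)) fun ξ hξ ↦ hm (i, e ξ) ξ hξ.2
  refine ⟨i, hi, e '' Z, ?_, (isCofinalIn_image_iff hαθ he hec).2 hZc, ?_⟩
  · rintro _ ⟨ξ, -, rfl⟩
    exact (hea ⟨ξ, rfl⟩).1
  · rintro _ ⟨ξ, hξ, rfl⟩ _ ⟨ζ, hζ, rfl⟩ h
    exact congrArg e (hinj hξ hζ (j.injective h))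

theorem exists_injective_bounded (hlam : ℵ₀ ≤ lam) :
    ∃ (ι : OrdBelow lam → OrdBelow (succ lam)) (a₀ : OrdBelow (succ lam)),
      Function.Injective ι ∧ ∀ x, ι x < a₀ := by
  obtain ⟨ι⟩ : #(OrdBelow lam) ≤ #(OrdBelow (succ lam)) := by
    rw [mk_ord_toType, mk_ord_toType]
    exact le_succ lam
  obtain ⟨a₀, ha₀⟩ := exists_strict_bound hlam (mk_ord_toType lam).le ι
  exact ⟨ι, a₀, ι.injective, ha₀⟩

theorem regressiveIdeal_subset (hlam : ℵ₀ < lam) (hχ : χ ≤ ℵ₀)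
    {I : Set (Set (OrdBelow (succ lam)))} (hI : IsCompleteIdeal (succ lam) I)
    (hgen : ∀ θ : Cardinal.{u}, θ < lam → meetingNumber (OrdBelow θ) lam θ χ = lam →
      ∀ d : OrdBelow (succ lam) × OrdBelow (succ lam) → OrdBelow lam,
        injectivitySet d ∩ cofSet (succ lam) θ ∈ I)
    (hns : nonstationaryIdeal (succ lam) ⊆ I) : regressiveIdeal χ (succ lam) ⊆ I := by
  rintro S ⟨C, hC, F, hFχ, hF⟩
  obtain ⟨ι, a₀, hι, hιa⟩ := exists_injective_bounded hlam.le
  obtain ⟨D, hD, hD'⟩ := exists_club_closed hlam.le (P := PUnit)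
    (by simpa using (one_le_aleph0.trans hlam.le)) a₀ fun _ η ↦ η
  have hcof : Order.cof (OrdBelow (succ lam)) ≠ ℵ₀ := by
    rw [cof_ordBelow_succ hlam.le]
    exact (hlam.trans (lt_succ lam)).ne'
  -- Indexing cofinalities below `lam` by ordinals `ζ` shows at once that there are at most `lam`
  -- pieces.
  let T (ζ : OrdBelow lam) : Set (OrdBelow (succ lam)) :=
    S ∩ (C ∩ D) ∩ cofSet (succ lam) #(Iio ζ)
  have hT (ζ : OrdBelow lam) : T ζ ∈ I := by
    rcases eq_empty_or_nonempty (T ζ) with h | ⟨α, ⟨hαS, hαC, hαD⟩, hα⟩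
    · exact h ▸ hI.empty_mem
    obtain ⟨ha₀, hlim, -⟩ := hD' α hαD
    have hθ : #(Iio ζ) ≠ 0 := fun h ↦
      (aleph0_le_cof_of_forall_exists_lt ha₀ hlim).not_gt (hα.trans h ▸ aleph0_pos)
    have hm := meetingNumber_eq_of_guesses hlam hχ hFχ hι hιa (hF α ⟨hαS, hαC⟩) ha₀ hα hθ
    obtain ⟨d, hd⟩ := exists_subset_injectivitySet hθ (mk_Iio_ordBelow_lt ζ).le hχ hFχ hι hιa
    exact hI.subset_mem _ (hgen _ (mk_Iio_ordBelow_lt ζ) hm d) _ fun β hβ ↦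
      ⟨hd β (hF β ⟨hβ.1.1, hβ.1.2.1⟩) (hD' β hβ.1.2.2).1 hβ.2, hβ.2⟩
  have hN : S \ (C ∩ D) ∈ I := hns <| not_isStationary_iff.2
    ⟨C ∩ D, hC.inter hcof hD, disjoint_sdiff_left⟩
  refine hI.subset_mem _ (hI.sUnion_mem (insert (S \ (C ∩ D)) (range T)) ?_ ?_) S fun α hα ↦ ?_
  · rintro _ (rfl | ⟨ζ, rfl⟩)
    exacts [hN, hT ζ]
  · refine lt_succ_of_le (mk_insert_le.trans (add_le_of_le hlam.le ?_
      (one_le_aleph0.trans hlam.le)))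
    exact mk_range_le.trans_eq (mk_ord_toType lam)
  · by_cases hαC : α ∈ C ∩ D
    · obtain ⟨ha₀, -, -⟩ := hD' α hαC.2
      have hlt : Order.cof (Iio α) < lam :=
        ((cof_le_cardinalMk _).trans (mk_Iio_le_of_succ α)).lt_of_ne
          ((show Guesses F α from hF α ⟨hα, hαC.1⟩).cof_ne hlam hχ hFχ hι hιa ha₀)
      let ζ : OrdBelow lam := Ordinal.ToType.mk ⟨(Order.cof (Iio α)).ord, ord_lt_ord.2 hlt⟩
      refine ⟨T ζ, .inr ⟨ζ, rfl⟩, ⟨hα, hαC⟩, ?_⟩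
      have : #(Iio ζ) = Order.cof (Iio α) := by
        have h : Ordinal.typein (α := OrdBelow lam) (· < ·) ζ = (Order.cof (Iio α)).ord :=
          congrArg Subtype.val (Ordinal.ToType.mk.symm_apply_apply
            (⟨(Order.cof (Iio α)).ord, ord_lt_ord.2 hlt⟩ : Iio lam.ord))
        exact (Ordinal.card_typein (r := fun x y : OrdBelow lam ↦ x < y) ζ).trans
          ((congrArg Ordinal.card h).trans (card_ord _))
      exact this.symm
    · exact ⟨_, .inl rfl, hα, hαC⟩

end Generation

theorem mainTheorem5 (lam : Cardinal.{u}) (hlam : ℵ₀ < lam)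
    (χ : Cardinal.{u}) (hχ : χ = 2 ∨ χ = ℵ₀) :
    IsLeast
      {I : Set (Set (OrdBelow (Order.succ lam))) |
        IsCompleteIdeal (Order.succ lam) I ∧
        {S | ∃ θ : Cardinal.{u}, θ < lam ∧ meetingNumber (OrdBelow θ) lam θ χ = lam ∧
            ∃ d : OrdBelow (Order.succ lam) × OrdBelow (Order.succ lam) → OrdBelow lam,
              S = injectivitySet d ∩ cofSet (Order.succ lam) θ}
          ∪ nonstationaryIdeal (Order.succ lam) ⊆ I}
      (regressiveIdeal χ (Order.succ lam)) := by
  have hχ₁ : χ ≤ ℵ₀ := by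
    rcases hχ with rfl | rfl
    exacts [ofNat_le_aleph0, le_rfl]
  have hχ₀ : χ ≠ 0 := by
    rcases hχ with rfl | rfl
    exacts [two_ne_zero, aleph0_ne_zero]
  refine ⟨⟨isCompleteIdeal_regressiveIdeal hlam.le hχ₀, union_subset ?_
    (nonstationaryIdeal_subset_regressiveIdeal hχ₀ _)⟩, fun I ⟨hI, hsub⟩ ↦ ?_⟩
  · rintro _ ⟨θ, -, hm, d, rfl⟩
    exact injectivitySet_inter_cofSet_mem hlam hχ₁ hχ₀ hm d
  · exact regressiveIdeal_subset hlam hχ₁ hI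
      (fun θ hθ hm d ↦ hsub (.inl ⟨θ, hθ, hm, d, rfl⟩)) fun S hS ↦ hsub (.inr hS)
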